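/- Let $\mathcal X$ be a finite-dimensional Euclidean space, let $f:\mathcal X\to[0,+\infty]$ be proper, closed (lower semicontinuous) and convex with $\inf f>0$ and $\operatorname{argmin} f\neq\emptyset$, and let $\alpha>0$. The perspective of $f$ is the function $f^\pi:\mathcal X\times\mathbb R\to[0,+\infty]$ given by $f^\pi(x,\lambda)=\lambda f(\lambda^{-1}x)$ if $\lambda>0$, $f^\pi(x,0)=f_\infty(x)$, and $f^\pi(x,\lambda)=+\infty$ if $\lambda<0$, where the recession function $f_\infty$ is the function whose epigraph is the asymptotic (recession) cone of the epigraph of $f$. With the Euclidean norm on $\mathcal X\times\mathbb R$, define the projected polar envelope $$p_{\alpha,f}(x)=(f^\pi)_\alpha(x,1)=\inf_{(z,\mu)\in\mathcal X\times\mathbb R}\max\Big\{f^\pi(z,\mu),\ \tfrac1\alpha\|(x,1)-(z,\mu)\|\Big\}$$ and let the projected polar proximal map send $x$ to the set of minimizers $(z,\mu)$ in this infimum. Then: (i) If $x\in\operatorname{argmin}p_{\alpha,f}$, then the projected polar proximal map at $x$ consists of exactly one point $(\bar x,\bar\lambda)$, and $\bar x=x$, $\bar\lambda>0$ and $\bar\lambda^{-1}x\in\operatorname{argmin}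 f$. (ii) If $x\in\operatorname{argmin} f$, then $\lambda x\in\operatorname{argmin}p_{\alpha,f}$, where $\lambda=[1+\alpha f(x)]^{-1}$. -/

import Mathlib

open scoped ENNReal NNReal Topology

noncomputable section

/-! Extended-real functions `f : X → [0, +∞]` are modelled with values in `ℝ≥0∞`. -/

/-- The epigraph `{(x, t) : f x ≤ t}` of `f : X → [0, +∞]`, a subset of `X × ℝ`. -/
def epigraph {X : Type*} (f : X → ℝ≥0∞) : Set (X × ℝ) :=
  {p | (f p.1 : EReal) ≤ (p.2 : EReal)}

/-- A function `f : X → [0, +∞]` is proper when it is finite somewhere. -/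
def IsProper {X : Type*} (f : X → ℝ≥0∞) : Prop := ∃ x, f x ≠ ∞

/-- The set of (global) minimizers of `f`. -/
def argmin {X : Type*} (f : X → ℝ≥0∞) : Set X := {x | ∀ y, f x ≤ f y}

/-- The recession (asymptotic) function of `f`: the function whose epigraph is the
asymptotic cone of the epigraph of `f` (see `epigraph_recessionFun`). -/
def recessionFun {X : Type*} [NormedAddCommGroup X] [NormedSpace ℝ X]
    (f : X → ℝ≥0∞) (d : X) : ℝ≥0∞ :=
  ⨅ (μ : ℝ≥0) (_ : (d, (μ : ℝ)) ∈ asymptoticCone ℝ (epigraph f)), (μ : ℝ≥0∞)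

theorem nonneg_of_mem_epigraph {X : Type*} {f : X → ℝ≥0∞} {p : X × ℝ}
    (hp : p ∈ epigraph f) : 0 ≤ p.2 := by
  have h : (0 : EReal) ≤ (p.2 : EReal) := (EReal.coe_ennreal_nonneg _).trans hp
  exact_mod_cast h

theorem nonneg_of_mem_asymptoticCone_epigraph {X : Type*} [NormedAddCommGroup X]
    [NormedSpace ℝ X] {f : X → ℝ≥0∞} {p : X × ℝ}
    (hp : p ∈ asymptoticCone ℝ (epigraph f)) : 0 ≤ p.2 := by
  have h1 : p ∈ asymptoticCone ℝ {q : X × ℝ | 0 ≤ q.2} :=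
    asymptoticCone_mono (fun q hq => nonneg_of_mem_epigraph hq) hp
  rw [asymptoticCone_eq_closure_of_forall_smul_mem
    (fun c hc x hx => by simpa using mul_nonneg hc.le hx)] at h1
  have hcl : IsClosed {q : X × ℝ | 0 ≤ q.2} := isClosed_le continuous_const continuous_snd
  rw [hcl.closure_eq] at h1
  exact h1

theorem add_mem_asymptoticCone_epigraph {X : Type*} [NormedAddCommGroup X]
    [NormedSpace ℝ X] {f : X → ℝ≥0∞} {d : X} {s t : ℝ}
    (hs : (d, s) ∈ asymptoticCone ℝ (epigraph f)) (hst : s ≤ t) :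
    (d, t) ∈ asymptoticCone ℝ (epigraph f) := by
  rw [mem_asymptoticCone_iff, AffineSpace.asymptoticNhds_eq_smul, ← Filter.map₂_smul,
    ← Filter.map_prod_eq_map₂, Filter.frequently_map] at hs ⊢
  have ht : Filter.Tendsto (fun q : ℝ × (X × ℝ) => (q.1, q.2 + ((0 : X), t - s)))
      (Filter.atTop ×ˢ 𝓝 (d, s)) (Filter.atTop ×ˢ 𝓝 (d, t)) := by
    refine Filter.tendsto_fst.prodMk ?_
    have := (Filter.tendsto_snd (f := (Filter.atTop : Filter ℝ)) (g := 𝓝 (d, s))).add_const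
      ((0 : X), t - s)
    simpa using this
  refine ht.frequently (Filter.Frequently.mp hs ?_)
  filter_upwards [Filter.tendsto_fst.eventually (Filter.eventually_ge_atTop (0 : ℝ))]
    with q hq hmem
  simp only [epigraph, Set.mem_ofPred_eq, Prod.smul_fst, Prod.smul_snd, Prod.fst_add,
    Prod.snd_add, add_zero] at hmem ⊢
  refine hmem.trans (EReal.coe_le_coe_iff.2 ?_)
  have := mul_nonneg hq (sub_nonneg.2 hst)
  simp only [smul_eq_mul]
  linarith

/-- The defining property of the recession function: `epi f_∞ = (epi f)_∞`. -/
theorem epigraph_recessionFun {X : Type*} [NormedAddCommGroup X] [NormedSpace ℝ X]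
    (f : X → ℝ≥0∞) :
    epigraph (recessionFun f) = asymptoticCone ℝ (epigraph f) := by
  ext ⟨d, t⟩
  constructor
  · intro h
    have ht : 0 ≤ t := nonneg_of_mem_epigraph h
    lift t to ℝ≥0 using ht
    have h' : recessionFun f d ≤ (t : ℝ≥0∞) := by
      have h2 : ((recessionFun f d : ℝ≥0∞) : EReal) ≤ ((t : ℝ≥0∞) : EReal) := h
      exact EReal.coe_ennreal_le_coe_ennreal_iff.1 h2
    have hc : ∀ e : ℝ, 0 < e → (d, (t : ℝ) + e) ∈ asymptoticCone ℝ (epigraph f) := by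
      intro e he
      lift e to ℝ≥0 using he.le
      have hlt : recessionFun f d < ((t + e : ℝ≥0) : ℝ≥0∞) :=
        h'.trans_lt (by exact_mod_cast lt_add_of_pos_right t (by exact_mod_cast he))
      simp only [recessionFun, iInf_lt_iff] at hlt
      obtain ⟨μ, hμ, hlt⟩ := hlt
      refine add_mem_asymptoticCone_epigraph hμ ?_
      exact_mod_cast (ENNReal.coe_lt_coe.1 hlt).le
    have hlim : Filter.Tendsto (fun e : ℝ => (d, (t : ℝ) + e)) (𝓝[>] 0) (𝓝 (d, (t : ℝ))) := by
      refine tendsto_const_nhds.prodMk_nhds ?_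
      have : Filter.Tendsto (fun e : ℝ => (t : ℝ) + e) (𝓝 0) (𝓝 ((t : ℝ) + 0)) :=
        tendsto_const_nhds.add Filter.tendsto_id
      rw [add_zero] at this
      exact this.mono_left nhdsWithin_le_nhds
    exact isClosed_asymptoticCone.mem_of_tendsto hlim
      (Filter.eventually_of_mem self_mem_nhdsWithin fun e he => hc e he)
  · intro h
    have ht : 0 ≤ t := nonneg_of_mem_asymptoticCone_epigraph h
    lift t to ℝ≥0 using ht
    have h' : recessionFun f d ≤ (t : ℝ≥0∞) := iInf₂_le t h
    exact (EReal.coe_ennreal_le_coe_ennreal_iff.2 h' :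
      ((recessionFun f d : ℝ≥0∞) : EReal) ≤ ((t : ℝ≥0∞) : EReal))

/-- The (closed) perspective `f^π` of `f`, on `X × ℝ` with the Euclidean product norm. -/
def perspective {X : Type*} [NormedAddCommGroup X] [NormedSpace ℝ X]
    (f : X → ℝ≥0∞) (p : WithLp 2 (X × ℝ)) : ℝ≥0∞ :=
  if 0 < p.snd then ENNReal.ofReal p.snd * f (p.snd⁻¹ • p.fst)
  else if p.snd = 0 then recessionFun f p.fst
  else ∞

/-- Infimal max convolution `(f₁ ⋄ f₂)(x) = inf_z max {f₁(z), f₂(x - z)}`. -/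
def maxConv {Y : Type*} [AddGroup Y] (f₁ f₂ : Y → ℝ≥0∞) (x : Y) : ℝ≥0∞ :=
  ⨅ z, max (f₁ z) (f₂ (x - z))

/-- The function `(1/α)‖·‖`. -/
def scaledNorm {Y : Type*} [NormedAddCommGroup Y] (α : ℝ) (y : Y) : ℝ≥0∞ :=
  ENNReal.ofReal (1 / α * ‖y‖)

/-- The polar envelope `κ_α = κ ⋄ (1/α)‖·‖`. -/
def polarEnvelope {Y : Type*} [NormedAddCommGroup Y] (α : ℝ) (κ : Y → ℝ≥0∞) : Y → ℝ≥0∞ :=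
  maxConv κ (scaledNorm α)

/-- The polar proximal map, as the set of minimizers of `z ↦ max {κ(z), (1/α)‖x - z‖}`. -/
def polarProx {Y : Type*} [NormedAddCommGroup Y] (α : ℝ) (κ : Y → ℝ≥0∞) (x : Y) : Set Y :=
  argmin fun z => max (κ z) (scaledNorm α (x - z))

/-- The projected polar envelope `p_{α,f}(x) = (f^π)_α(x, 1)`. -/
def projPolarEnvelope {X : Type*} [NormedAddCommGroup X] [NormedSpace ℝ X]
    (α : ℝ) (f : X → ℝ≥0∞) (x : X) : ℝ≥0∞ :=
  polarEnvelope α (perspective f) (WithLp.toLp 2 (x, 1))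

/-- The projected polar proximal map: the polar proximal map of `f^π` at `(x, 1)`. -/
def projPolarProx {X : Type*} [NormedAddCommGroup X] [NormedSpace ℝ X]
    (α : ℝ) (f : X → ℝ≥0∞) (x : X) : Set (WithLp 2 (X × ℝ)) :=
  polarProx α (perspective f) (WithLp.toLp 2 (x, 1))

end

/-! Let `m = min f > 0`. If the objective at `(z, μ)` is at most `t`, then its two terms give `μ * m
≤ t` and `1 - μ ≤ α * t` (`bounds_of_objective_le`). Eliminating `μ` gives `t ≥ v := m / (1 + α *
m)`, and `t = v` forces `μ = l := (1 + α * m)⁻¹` and `z = x`. The bound is attained at `(x, l)` when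
`l⁻¹ • x` minimizes `f`, which gives (ii) and `min p = v`. For (i), a minimizing sequence at a point
where `p = v` is squeezed to `(x, l)`, so lower semicontinuity yields `f (l⁻¹ • x) ≤ m`. -/

theorem le_of_sq_add_sq_le {a b c : ℝ} (hc : 0 ≤ c) (h : a ^ 2 + b ^ 2 ≤ c ^ 2) : b ≤ c :=
  abs_le_of_sq_le_sq' (by linarith [sq_nonneg a]) hc |>.2

section

variable {X : Type*} [NormedAddCommGroup X] [NormedSpace ℝ X]
  {f : X → ℝ≥0∞} {α m t : ℝ}

theorem perspective_of_pos {p : WithLp 2 (X × ℝ)} (hp : 0 < p.snd) :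
    perspective f p = ENNReal.ofReal p.snd * f (p.snd⁻¹ • p.fst) := by
  simp [perspective, hp]

/-- Bounds on a point at which the objective defining the projected polar envelope is at most
`t`, in terms of a lower bound `m` of `f`. -/
theorem bounds_of_objective_le {x : X} {p : WithLp 2 (X × ℝ)} (hα : 0 < α)
    (hf : ∀ y, ENNReal.ofReal m ≤ f y) (ht : 0 ≤ t)
    (h : max (perspective f p) (scaledNorm α (WithLp.toLp 2 (x, 1) - p)) ≤ ENNReal.ofReal t) :
    0 ≤ p.snd ∧ p.snd * m ≤ t ∧ ‖x - p.fst‖ ^ 2 + (1 - p.snd) ^ 2 ≤ (α * t) ^ 2 := by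
  obtain ⟨h1, h2⟩ := max_le_iff.1 h
  have hnorm : ‖x - p.fst‖ ^ 2 + (1 - p.snd) ^ 2 ≤ (α * t) ^ 2 := by
    rw [scaledNorm, ENNReal.ofReal_le_ofReal_iff ht, one_div, inv_mul_le_iff₀ hα] at h2
    have h3 := pow_le_pow_left₀ (norm_nonneg _) h2 2
    rw [WithLp.prod_norm_sq_eq_of_L2] at h3
    simpa using h3
  rcases lt_trichotomy p.snd 0 with hp | hp | hp
  · simp [perspective, hp.not_gt, hp.ne] at h1
  -- At `μ = 0` the bound `μ * m ≤ t` reads `0 ≤ t`, whatever the recession function is.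
  · exact ⟨hp.ge, by simpa [hp] using ht, hnorm⟩
  · refine ⟨hp.le, ?_, hnorm⟩
    rw [perspective_of_pos hp] at h1
    rw [← ENNReal.ofReal_le_ofReal_iff ht, ENNReal.ofReal_mul hp.le]
    exact (mul_le_mul_right (hf _) _).trans h1

theorem le_projPolarEnvelope (hα : 0 < α) (hm : 0 ≤ m)
    (hf : ∀ y, ENNReal.ofReal m ≤ f y) (x : X) :
    ENNReal.ofReal ((1 + α * m)⁻¹ * m) ≤ projPolarEnvelope α f x := by
  refine le_iInf fun p => ?_
  by_cases htop : max (perspective f p) (scaledNorm α (WithLp.toLp 2 (x, 1) - p)) = ∞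
  · simp [htop]
  obtain ⟨-, h1, h2⟩ := bounds_of_objective_le hα hf ENNReal.toReal_nonneg
    (ENNReal.ofReal_toReal htop).ge
  have h3 := le_of_sq_add_sq_le (mul_nonneg hα.le ENNReal.toReal_nonneg) h2
  refine (ENNReal.ofReal_le_iff_le_toReal htop).2 ?_
  rw [inv_mul_le_iff₀ (by positivity)]
  -- Adding `μ * m ≤ t` to `m` times `1 - μ ≤ α * t` eliminates `μ`: `m ≤ (1 + α * m) * t`.
  nlinarith [mul_le_mul_of_nonneg_right h3 hm]

/-- The objective of the projected polar envelope at `x`, evaluated at the point `(x, l)` with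
`l = (1 + α m)⁻¹`, when `l⁻¹ x` attains the value `m`. -/
theorem objective_eq {x : X} (hα : 0 < α) (hm : 0 ≤ m)
    (hx : f ((1 + α * m) • x) = ENNReal.ofReal m) :
    max (perspective f (WithLp.toLp 2 (x, (1 + α * m)⁻¹)))
        (scaledNorm α (WithLp.toLp 2 (x, 1) - WithLp.toLp 2 (x, (1 + α * m)⁻¹)))
      = ENNReal.ofReal ((1 + α * m)⁻¹ * m) := by
  have hpos : 0 < (1 + α * m)⁻¹ := by positivity
  have hsub : 1 - (1 + α * m)⁻¹ = α * ((1 + α * m)⁻¹ * m) := by field_simp; ring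
  have hn : ‖(WithLp.toLp 2 (x, (1 : ℝ)) - WithLp.toLp 2 (x, (1 + α * m)⁻¹) :
      WithLp 2 (X × ℝ))‖ = α * ((1 + α * m)⁻¹ * m) := by
    rw [← sq_eq_sq₀ (norm_nonneg _) (by positivity), WithLp.prod_norm_sq_eq_of_L2]
    simp [hsub, mul_pow]
  rw [perspective_of_pos (by simpa using hpos), scaledNorm, hn]
  simp only [WithLp.toLp_fst, WithLp.toLp_snd, inv_inv, hx]
  rw [← ENNReal.ofReal_mul hpos.le, one_div, inv_mul_cancel_left₀ hα.ne', max_self]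

theorem projPolarEnvelope_smul_eq {x : X} (hα : 0 < α) (hm : 0 ≤ m)
    (hf : ∀ y, ENNReal.ofReal m ≤ f y) (hx : f x = ENNReal.ofReal m) :
    projPolarEnvelope α f ((1 + α * m)⁻¹ • x) = ENNReal.ofReal ((1 + α * m)⁻¹ * m) := by
  refine le_antisymm ?_ (le_projPolarEnvelope hα hm hf _)
  rw [← objective_eq (f := f) (x := (1 + α * m)⁻¹ • x) hα hm
    (by rw [smul_inv_smul₀ (by positivity), hx])]
  exact iInf_le _ _

/-- At the value `v` the upper and lower bounds on `μ` coincide, which gives uniqueness of the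
minimizer. -/
theorem eq_of_objective_le {x : X} {p : WithLp 2 (X × ℝ)} (hα : 0 < α) (hm : 0 < m)
    (hf : ∀ y, ENNReal.ofReal m ≤ f y)
    (h : max (perspective f p) (scaledNorm α (WithLp.toLp 2 (x, 1) - p)) ≤
      ENNReal.ofReal ((1 + α * m)⁻¹ * m)) :
    p = WithLp.toLp 2 (x, (1 + α * m)⁻¹) := by
  have hv : 0 ≤ (1 + α * m)⁻¹ * m := by positivity
  have hsub : 1 - (1 + α * m)⁻¹ = α * ((1 + α * m)⁻¹ * m) := by field_simp; ring
  obtain ⟨-, h1, h2⟩ := bounds_of_objective_le hα hf hv h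
  have h3 := le_of_sq_add_sq_le (mul_nonneg hα.le hv) h2
  have hs : p.snd = (1 + α * m)⁻¹ :=
    le_antisymm (le_of_mul_le_mul_right h1 hm) (by linarith)
  -- The last coordinate alone uses up the whole radius `α * v`, leaving nothing for `x - z`.
  rw [hs, hsub] at h2
  have hz : x - p.fst = 0 := by
    rw [← norm_eq_zero, ← sq_eq_zero_iff]
    exact le_antisymm (by linarith) (sq_nonneg _)
  refine (WithLp.equiv 2 (X × ℝ)).injective (Prod.ext ?_ ?_)
  · exact (sub_eq_zero.1 hz).symm
  · exact hs

/-- Where the projected polar envelope attains its lower bound, the rescaled point minimizes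
`f`. -/
theorem le_of_projPolarEnvelope_le {x : X} (hlsc : LowerSemicontinuous f) (hα : 0 < α)
    (hm : 0 < m) (hf : ∀ y, ENNReal.ofReal m ≤ f y)
    (h : projPolarEnvelope α f x ≤ ENNReal.ofReal ((1 + α * m)⁻¹ * m)) :
    f ((1 + α * m) • x) ≤ ENNReal.ofReal m := by
  set l := (1 + α * m)⁻¹ with hl
  have hlpos : 0 < l := by positivity
  have hsub : 1 - l = α * (l * m) := by rw [hl]; field_simp; ring
  let t : ℕ → ℝ := fun n => l * m + 1 / ((n : ℝ) + 1)
  have htpos : ∀ n, l * m < t n := fun n => lt_add_of_pos_right _ (by positivity)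
  have ht0 : ∀ n, 0 ≤ t n := fun n => (by positivity : 0 ≤ l * m).trans (htpos n).le
  have htlim : Filter.Tendsto t Filter.atTop (𝓝 (l * m)) := by
    simpa [t] using tendsto_one_div_add_atTop_nhds_zero_nat.const_add (l * m)
  have hex : ∀ n, ∃ p : WithLp 2 (X × ℝ),
      max (perspective f p) (scaledNorm α (WithLp.toLp 2 (x, 1) - p)) < ENNReal.ofReal (t n) :=
    fun n => iInf_lt_iff.1 (h.trans_lt
      ((ENNReal.ofReal_lt_ofReal_iff ((by positivity : 0 ≤ l * m).trans_lt (htpos n))).2 (htpos n)))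
  choose p hp using hex
  have hb := fun n => bounds_of_objective_le hα hf (ht0 n) (hp n).le
  have hμ : Filter.Tendsto (fun n => (p n).snd) Filter.atTop (𝓝 l) := by
    -- Both sides of `1 - α * t n ≤ μ ≤ t n / m` tend to `l`, so the full sequence converges.
    refine tendsto_of_tendsto_of_tendsto_of_le_of_le (g := fun n => 1 - α * t n)
      (h := fun n => t n / m) ?_ ?_ (fun n => ?_) (fun n => ?_)
    · have := (htlim.const_mul α).const_sub 1
      rwa [← hsub, sub_sub_cancel] at this
    · have := htlim.div_const m
      rwa [mul_div_cancel_right₀ _ hm.ne'] at this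
    · linarith [le_of_sq_add_sq_le (mul_nonneg hα.le (ht0 n)) (hb n).2.2]
    · exact (le_div_iff₀ hm).2 (hb n).2.1
  have hz : Filter.Tendsto (fun n => (p n).fst) Filter.atTop (𝓝 x) := by
    have h1 : Filter.Tendsto (fun n => (α * t n) ^ 2 - (1 - (p n).snd) ^ 2) Filter.atTop
        (𝓝 0) := by
      have := ((htlim.const_mul α).pow 2).sub ((hμ.const_sub 1).pow 2)
      rwa [← hsub, sub_self] at this
    have h2 : Filter.Tendsto (fun n => ‖x - (p n).fst‖ ^ 2) Filter.atTop (𝓝 0) :=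
      squeeze_zero (fun n => sq_nonneg _) (fun n => by linarith [(hb n).2.2]) h1
    have h3 : Filter.Tendsto (fun n => ‖x - (p n).fst‖) Filter.atTop (𝓝 0) := by
      simpa using h2.sqrt
    refine tendsto_iff_norm_sub_tendsto_zero.2 ?_
    simpa only [norm_sub_rev] using h3
  have hy : Filter.Tendsto (fun n => (p n).snd⁻¹ • (p n).fst) Filter.atTop
      (𝓝 ((1 + α * m) • x)) := by
    simpa [hl] using (hμ.inv₀ hlpos.ne').smul hz
  have hq : Filter.Tendsto (fun n => ENNReal.ofReal ((p n).snd⁻¹ * t n)) Filter.atTop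
      (𝓝 (ENNReal.ofReal m)) := by
    have := ENNReal.tendsto_ofReal ((hμ.inv₀ hlpos.ne').mul htlim)
    rwa [inv_mul_cancel_left₀ hlpos.ne'] at this
  -- Any `d` below `f` at the limit is eventually below `f (μ⁻¹ • z) ≤ μ⁻¹ * t n`, whose right side
  -- tends to `m`.
  refine le_of_forall_lt fun c hc => ?_
  obtain ⟨d, hcd, hd⟩ := exists_between hc
  refine hcd.trans_le (ge_of_tendsto hq ?_)
  filter_upwards [hy.eventually (hlsc _ d hd), hμ.eventually (lt_mem_nhds hlpos)] with n h1 h2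
  have h3 := (max_le_iff.1 (hp n).le).1
  rw [perspective_of_pos h2] at h3
  have h4 := mul_le_mul_right h3 (ENNReal.ofReal (p n).snd⁻¹)
  rw [← mul_assoc, ← ENNReal.ofReal_mul (by positivity), inv_mul_cancel₀ h2.ne',
    ENNReal.ofReal_one, one_mul, ← ENNReal.ofReal_mul (by positivity)] at h4
  exact h1.le.trans h4

end

theorem mainTheorem4 {X : Type*} [NormedAddCommGroup X] [InnerProductSpace ℝ X]
    [FiniteDimensional ℝ X] (f : X → ℝ≥0∞)
    (hproper : IsProper f) (hclosed : LowerSemicontinuous f)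
    (hconvex : ConvexOn ℝ≥0 Set.univ f)
    (hinf : 0 < ⨅ x, f x) (hmin : (argmin f).Nonempty)
    (α : ℝ) (hα : 0 < α) :
    (∀ x ∈ argmin (projPolarEnvelope α f), ∃ (x' : X) (l : ℝ),
      projPolarProx α f x = {WithLp.toLp 2 (x', l)} ∧
        x' = x ∧ 0 < l ∧ l⁻¹ • x ∈ argmin f) ∧
    (∀ x ∈ argmin f, (1 + α * (f x).toReal)⁻¹ • x ∈ argmin (projPolarEnvelope α f)) := by
  have hval : ∀ y ∈ argmin f, f y = ENNReal.ofReal (f y).toReal ∧ 0 < (f y).toReal := by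
    intro y hy
    obtain ⟨w, hw⟩ := hproper
    have hfin : f y ≠ ∞ := ne_top_of_le_ne_top hw (hy w)
    exact ⟨(ENNReal.ofReal_toReal hfin).symm,
      ENNReal.toReal_pos (hinf.trans_le (iInf_le f y)).ne' hfin⟩
  refine ⟨fun x hx => ?_, fun x hx y => ?_⟩
  · obtain ⟨y, hy⟩ := hmin
    obtain ⟨hfy, hm⟩ := hval y hy
    set m := (f y).toReal
    have hf : ∀ w, ENNReal.ofReal m ≤ f w := fun w => hfy ▸ hy w
    have hle : f ((1 + α * m) • x) ≤ ENNReal.ofReal m :=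
      le_of_projPolarEnvelope_le hclosed hα hm hf
        -- The minimizer `x` is compared with `l • y`, where the envelope equals `v`.
        ((hx _).trans (projPolarEnvelope_smul_eq hα hm.le hf hfy).le)
    have hobj := objective_eq hα hm.le (hle.antisymm (hf _))
    refine ⟨x, (1 + α * m)⁻¹, ?_, rfl, by positivity, ?_⟩
    · refine Set.eq_singleton_iff_unique_mem.2 ⟨fun q => ?_, fun q hq => ?_⟩
      · exact hobj.le.trans ((le_projPolarEnvelope hα hm.le hf x).trans (iInf_le _ q))
      · exact eq_of_objective_le hα hm hf ((hq _).trans hobj.le)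
    · rw [inv_inv]
      exact fun w => hle.trans (hf w)
  · obtain ⟨hfx, hm⟩ := hval x hx
    have hf : ∀ w, ENNReal.ofReal (f x).toReal ≤ f w := fun w => hfx ▸ hx w
    exact (projPolarEnvelope_smul_eq hα hm.le hf hfx).le.trans
      (le_projPolarEnvelope hα hm.le hf y)
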